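/- Graphs are finite and simple. A \emph{stub graph} $G$ is a graph $G^-$ together with a finite set of \emph{stubs}, each of which is incident with exactly one vertex of $G^-$ and carries a positive integer, its \emph{index}; a vertex may be incident with arbitrarily many stubs. The \emph{edge set} $E(G)$ consists of the edges of $G^-$ and the stubs, and the \emph{degree} of a vertex in $G$ is the number of edges and stubs incident with it. $G$ is \emph{$k$-edge-connected} if $G^-$ is, that is, if $G^-$ remains connected after the removal of any fewer than $k$ edges. For any positive integers $k_0$ and $\delta_0$ there exists $d_0$ such that, for every $16k_0$-edge-connected stub graph $G$ in which every vertex has degree at least $d_0$, the edge set $E(G)$ can be partitioned into two sets $E_1$ and $E_2$ (stubs keeping their incident vertex and index) such that $E_1$ contains no stubs, the graph $(V(G),E_1)$ is $k_0$-edge-connected, and the stub graph $(V(G),E_2)$ has minimum degree at least $\delta_0$. -/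

import Mathlib

universe u v

/-- A stub graph with vertex set `V`: a simple graph on `V` together with a set of stubs
(hyperedges of size one), named by elements of `S`. Each stub is incident with one vertex
and carries a positive integer, its index. -/
@[ext]
structure StubGraph (V : Type u) (S : Type v) where
  /-- The graph `G⁻` obtained by removing all the stubs. -/
  graph : SimpleGraph V
  /-- The set of stubs. -/
  stubs : Set S
  /-- The vertex incident with a stub. -/
  stubEnd : stubs → V
  /-- The index of a stub. -/
  index : stubs → ℕ+

namespace StubGraph

variable {V : Type u} {S : Type v}

/-- The edge set `E(G)`, consisting of the edges and the stubs of `G`. -/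
def edgeSet (G : StubGraph V S) : Set (Sym2 V ⊕ S) :=
  Sum.inl '' G.graph.edgeSet ∪ Sum.inr '' G.stubs

/-- The degree of a vertex: the number of edges and stubs incident with it. -/
noncomputable def degree (G : StubGraph V S) (x : V) : ℕ :=
  (G.graph.incidenceSet x).ncard + {s : G.stubs | G.stubEnd s = x}.ncard

/-- The minimum degree of `G` is at least `d`. -/
def MinDegreeGE (G : StubGraph V S) (d : ℕ) : Prop :=
  ∀ x : V, d ≤ G.degree x

/-- `G` is `k`-edge-connected if the graph `G⁻` is. -/
def IsEdgeConnected (G : StubGraph V S) (k : ℕ) : Prop :=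
  G.graph.IsEdgeConnected k

/-- `G` is a graph, that is, it has no stubs. -/
def IsGraph (G : StubGraph V S) : Prop :=
  G.stubs = ∅

/-- `H` is a (spanning) subgraph of `G`: edges of `H` are edges of `G`, and stubs of `H` are
stubs of `G`, with the same incident vertex and the same index. -/
structure IsSpanningSubgraph (H G : StubGraph V S) : Prop where
  graph_le : H.graph ≤ G.graph
  stubs_subset : H.stubs ⊆ G.stubs
  stubEnd_eq : ∀ s : H.stubs, H.stubEnd s = G.stubEnd ⟨s, stubs_subset s.2⟩
  index_eq : ∀ s : H.stubs, H.index s = G.index ⟨s, stubs_subset s.2⟩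

/-- The edge set of `G` is decomposed into the edge sets of its edge-disjoint spanning
subgraphs `A` and `B`. -/
structure IsDecomposition (G A B : StubGraph V S) : Prop where
  left_subgraph : A.IsSpanningSubgraph G
  right_subgraph : B.IsSpanningSubgraph G
  disjoint : Disjoint A.edgeSet B.edgeSet
  union_eq : A.edgeSet ∪ B.edgeSet = G.edgeSet

end StubGraph

/-! All stubs go to E₂, so it suffices to find a set T of edges with δ₀ edges at every vertex of
large degree in G⁻ whose removal leaves a k₀-edge-connected graph. Ask for more: after removing T,
every vertex partition P is still crossed by at least k₀(|P| - 1) edges. By Nash-Williams and Tutte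
this means k₀ disjoint spanning trees; partitions into two classes give the edge-connectivity. Such
sets T are the independent sets of a matroid whose rank function is the minimum of `slack` over P,
and uncrossing works because |P| is supermodular on the partition lattice. Rado's theorem, applied
to the incidence sets, each repeated δ₀ times, then yields T. Its rank condition holds with room to
spare: the degrees bound the number of representatives by half of the relevant edges, and
16k₀-edge-connectivity bounds k₀|P| by an eighth of them. -/

/-! ### Rado's theorem by uncrossing -/

section Transversal

open Finset

/-- Each element of the union of a family, covered at most `n` times, is counted at most
`n` times by the sum of the sizes. -/
theorem Finset.sum_card_le_mul_card_biUnion {ι α : Type*} [DecidableEq α] (J : Finset ι)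
    (A : ι → Finset α) (n : ℕ) (h : ∀ a, #{i ∈ J | a ∈ A i} ≤ n) :
    ∑ i ∈ J, #(A i) ≤ n * #(J.biUnion A) := by
  have key := sum_card_bipartiteAbove_eq_sum_card_bipartiteBelow (s := J) (t := J.biUnion A)
    (fun i a => a ∈ A i)
  have hA : ∀ i ∈ J, (J.biUnion A).bipartiteAbove (fun i a => a ∈ A i) i = A i := by
    intro i hi
    ext a
    simp only [mem_bipartiteAbove, mem_biUnion, and_iff_right_iff_imp]
    exact fun ha => ⟨i, hi, ha⟩
  rw [sum_congr rfl fun i hi => by rw [hA i hi]] at key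
  rw [key, mul_comm]
  exact sum_le_card_nsmul _ _ _ fun a _ => h a

/-- A version of Rado's transversal theorem. The rank function is given as the pointwise infimum
of a family `h` of monotone functions satisfying an uncrossing property. -/
theorem exists_transversal_of_uncrossing {ι α κ : Type*} [Fintype ι] [DecidableEq ι]
    [DecidableEq α] (h : κ → Finset α → ℤ) (hmono : ∀ p, Monotone (h p))
    (huncross : ∀ p q X Y, ∃ r s, h r (X ∪ Y) + h s (X ∩ Y) ≤ h p X + h q Y)
    (hempty : ∃ p, h p ∅ ≤ 0) (A : ι → Finset α)
    (hA : ∀ (J : Finset ι) (p : κ), (#J : ℤ) ≤ h p (J.biUnion A)) :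
    ∃ t : ι → α, (∀ i, t i ∈ A i) ∧ ∀ p, (Fintype.card ι : ℤ) ≤ h p (univ.image t) := by
  induction hn : ∑ i, #(A i) using Nat.strong_induction_on generalizing A with
  | _ n ih =>
  have hne : ∀ i, (A i).Nonempty := by
    intro i
    by_contra hi
    obtain ⟨p, hp⟩ := hempty
    have := hA {i} p
    rw [not_nonempty_iff_eq_empty] at hi
    simp [hi] at this
    omega
  by_cases hcard : ∀ i, #(A i) ≤ 1
  · choose t ht using hne
    refine ⟨t, ht, fun p => (hA univ p).trans (hmono p ?_)⟩
    intro a ha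
    simp only [mem_biUnion, mem_univ, true_and, mem_image] at ha ⊢
    obtain ⟨i, hi⟩ := ha
    exact ⟨i, card_le_one.mp (hcard i) _ (ht i) _ hi⟩
  push Not at hcard
  obtain ⟨i, hi⟩ := hcard
  obtain ⟨a, ha, b, hb, hab⟩ := one_lt_card.mp hi
  -- Removing `c` from `A i` either keeps the hypothesis or exhibits a tight set.
  have step : ∀ c ∈ A i, (∃ t : ι → α, (∀ i, t i ∈ A i) ∧
      ∀ p, (Fintype.card ι : ℤ) ≤ h p (univ.image t)) ∨
      ∃ (J : Finset ι) (p : κ), i ∉ J ∧ h p (J.biUnion A ∪ (A i).erase c) ≤ #J := by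
    intro c hc
    set A' := Function.update A i ((A i).erase c) with hA'
    have hle : ∀ j, A' j ⊆ A j := by
      intro j
      by_cases hj : j = i
      · subst hj
        simp [hA', erase_subset]
      · simp [hA', hj]
    by_cases hgood : ∀ (J : Finset ι) (p : κ), (#J : ℤ) ≤ h p (J.biUnion A')
    · left
      obtain ⟨t, ht, ht'⟩ := ih (∑ j, #(A' j)) (by
        rw [← hn]
        refine sum_lt_sum (fun j _ => card_le_card (hle j)) ⟨i, mem_univ i, ?_⟩
        simp only [hA', Function.update_self]
        exact card_erase_lt_of_mem hc) A' hgood rfl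
      exact ⟨t, fun j => hle j (ht j), ht'⟩
    · right
      push Not at hgood
      obtain ⟨J, p, hJ⟩ := hgood
      have agree : ∀ K : Finset ι, i ∉ K → K.biUnion A' = K.biUnion A := by
        intro K hK
        refine biUnion_congr rfl fun j hj => ?_
        have : j ≠ i := fun h => hK (h ▸ hj)
        simp [hA', this]
      have hiJ : i ∈ J := by
        by_contra hiJ
        rw [agree J hiJ] at hJ
        exact absurd (hA J p) (not_le.mpr hJ)
      refine ⟨J.erase i, p, notMem_erase i J, ?_⟩
      have hU : J.biUnion A' = (J.erase i).biUnion A ∪ (A i).erase c := by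
        conv_lhs => rw [← insert_erase hiJ]
        rw [biUnion_insert, agree _ (notMem_erase i J), union_comm]
        simp [hA']
      rw [← hU]
      have := card_erase_add_one hiJ
      omega
  rcases step a ha with h1 | ⟨J, p, hiJ, hJ⟩
  · exact h1
  rcases step b hb with h1 | ⟨K, q, hiK, hK⟩
  · exact h1
  exfalso
  -- Uncross the two tight sets. As a ≠ b, their union contains all of `A i` and so serves `J ∪ K`
  -- and i, while their intersection serves `J ∩ K`: one index too many.
  obtain ⟨r, s, hrs⟩ := huncross p q (J.biUnion A ∪ (A i).erase a) (K.biUnion A ∪ (A i).erase b)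
  have h1 : ((insert i (J ∪ K)).biUnion A) ⊆
      (J.biUnion A ∪ (A i).erase a) ∪ (K.biUnion A ∪ (A i).erase b) := by
    intro x
    simp only [biUnion_insert, union_biUnion, mem_union, mem_erase]
    by_cases hx : x = a
    · subst hx
      tauto
    · tauto
  have h2 : (J ∩ K).biUnion A ⊆
      (J.biUnion A ∪ (A i).erase a) ∩ (K.biUnion A ∪ (A i).erase b) := by
    intro x
    simp only [mem_biUnion, mem_inter, mem_union]
    rintro ⟨j, ⟨hj, hj'⟩, hx⟩
    exact ⟨Or.inl ⟨j, hj, hx⟩, Or.inl ⟨j, hj', hx⟩⟩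
  have h3 := (hA _ r).trans (hmono r h1)
  have h4 := (hA _ s).trans (hmono s h2)
  rw [card_insert_of_notMem (by simp [hiJ, hiK])] at h3
  have h5 := card_union_add_card_inter J K
  push_cast at h3
  omega

end Transversal

/-! ### Supermodularity of the number of classes -/

namespace Setoid

variable {V : Type*}

/-- The space of real functions that are constant on the classes of a setoid. -/
def constantFunctions (P : Setoid V) : Submodule ℝ (V → ℝ) where
  carrier := {f | ∀ x y, P x y → f x = f y}
  add_mem' hf hg x y h := by simp [hf x y h, hg x y h]
  zero_mem' _ _ _ := rfl
  smul_mem' c f hf x y h := by simp [hf x y h]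

/-- A function constant on the classes is the same as a function on the quotient. -/
def constantFunctionsEquiv (P : Setoid V) : P.constantFunctions ≃ₗ[ℝ] (Quotient P → ℝ) where
  toFun f := fun c => Quotient.lift f.1 f.2 c
  map_add' f g := by
    funext c
    induction c using Quotient.inductionOn
    rfl
  map_smul' a f := by
    funext c
    induction c using Quotient.inductionOn
    rfl
  invFun g := ⟨fun x => g (Quotient.mk P x), fun x y h => congrArg g (Quotient.sound h)⟩
  left_inv f := rfl
  right_inv g := by
    funext c
    induction c using Quotient.inductionOn
    rfl

theorem finrank_constantFunctions [Finite V] (P : Setoid V) :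
    Module.finrank ℝ P.constantFunctions = Nat.card (Quotient P) := by
  have := Fintype.ofFinite (Quotient P)
  rw [P.constantFunctionsEquiv.finrank_eq, Module.finrank_fintype_fun_eq_card,
    Nat.card_eq_fintype_card]

/-- The number of classes is a supermodular function on the lattice of setoids. -/
theorem card_quotient_add_le [Finite V] (P Q : Setoid V) :
    Nat.card (Quotient P) + Nat.card (Quotient Q) ≤
      Nat.card (Quotient (P ⊓ Q)) + Nat.card (Quotient (P ⊔ Q)) := by
  simp only [← finrank_constantFunctions]
  -- Dimension formula: the sum of the two spaces consists of functions constant on the classes of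
  -- `P ⊓ Q`, their intersection of functions constant on those of `P ⊔ Q`.
  rw [← Submodule.finrank_sup_add_finrank_inf_eq]
  refine add_le_add (Submodule.finrank_mono ?_) (Submodule.finrank_mono ?_)
  · refine sup_le ?_ ?_
    · exact fun f hf x y h => hf x y (Setoid.inf_iff_and.mp h).1
    · exact fun f hf x y h => hf x y (Setoid.inf_iff_and.mp h).2
  · rintro f ⟨hP, hQ⟩
    have : P ⊔ Q ≤ Setoid.ker f := sup_le (fun {x y} h => hP x y h) (fun {x y} h => hQ x y h)
    exact fun x y h => this h

end Setoid

/-! ### Edge-connectivity by cuts -/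

namespace SimpleGraph

variable {V : Type*}

/-- A finite graph is `k`-edge-connected if and only if every edge cut has at least `k` edges. -/
theorem isEdgeConnected_iff_le_card_cut [Finite V] (H : SimpleGraph V) (k : ℕ) :
    H.IsEdgeConnected k ↔ ∀ (U : Set V) (u v : V), u ∈ U → v ∉ U → ∀ s : Finset (Sym2 V),
      (∀ a b, a ∈ U → b ∉ U → H.Adj a b → s(a, b) ∈ s) → k ≤ s.card := by
  constructor
  · intro h U u v hu hv s hs
    by_contra hlt
    obtain ⟨p⟩ := h u v (s := s) (by
      rw [Set.encard_coe_eq_coe_finsetCard]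
      exact_mod_cast not_le.mp hlt)
    obtain ⟨d, -, hd1, hd2⟩ := p.exists_boundary_dart U hu hv
    have hadj := d.adj
    rw [deleteEdges_adj] at hadj
    exact hadj.2 (hs _ _ hd1 hd2 hadj.1)
  · intro h u v s hs
    by_contra hr
    have hfin : s.Finite := Set.toFinite s
    have := h {w | (H.deleteEdges s).Reachable u w} u v (Reachable.refl u) hr hfin.toFinset (by
      intro a b ha hb hab
      rw [Set.Finite.mem_toFinset]
      by_contra hn
      exact hb (ha.trans (Adj.reachable (deleteEdges_adj.mpr ⟨hab, hn⟩))))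
    rw [hfin.encard_eq_coe_toFinset_card] at hs
    exact absurd this (not_le.mpr (by exact_mod_cast hs))

/-! ### Crossing edges, slack and the removable set -/

section Crossing

open Finset
open scoped Classical

variable [Fintype V]

/-- The edges joining two different classes of a setoid. -/
noncomputable def crossingEdges (H : SimpleGraph V) (P : Setoid V) : Finset (Sym2 V) :=
  {e ∈ H.edgeFinset | ¬ ∀ u ∈ e, ∀ v ∈ e, P u v}

theorem mem_crossingEdges {H : SimpleGraph V} {P : Setoid V} {a b : V} :
    s(a, b) ∈ H.crossingEdges P ↔ H.Adj a b ∧ ¬ P a b := by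
  simp only [crossingEdges, mem_filter, mem_edgeFinset, mem_edgeSet, Sym2.mem_iff,
    forall_eq_or_imp, forall_eq]
  have := P.refl a
  have := P.refl b
  have : P a b → P b a := fun h => P.symm h
  tauto

theorem crossingEdges_inf (H : SimpleGraph V) (P Q : Setoid V) :
    H.crossingEdges (P ⊓ Q) = H.crossingEdges P ∪ H.crossingEdges Q := by
  ext ⟨a, b⟩
  have : (P ⊓ Q) a b ↔ P a b ∧ Q a b := Setoid.inf_iff_and
  simp only [mem_union, mem_crossingEdges, this]
  tauto

theorem crossingEdges_anti (H : SimpleGraph V) : Antitone H.crossingEdges := by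
  rintro P Q h ⟨a, b⟩
  simp only [mem_crossingEdges]
  exact fun hab => ⟨hab.1, fun hP => hab.2 (h hP)⟩

/-- The number of edges in `X` or crossing `P`, minus those needed to keep the quotient by `P`
`k`-fold connected. If all these numbers are at least `#X`, then removing `X` from `H` leaves
at least `k (|P| - 1)` edges crossing `P`. -/
noncomputable def slack (H : SimpleGraph V) (k : ℕ) (P : Setoid V) (X : Finset (Sym2 V)) : ℤ :=
  #(X ∪ H.crossingEdges P) - k * ((Nat.card (Quotient P) : ℤ) - 1)

theorem slack_mono (H : SimpleGraph V) (k : ℕ) (P : Setoid V) : Monotone (H.slack k P) := by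
  intro X Y h
  have : #(X ∪ H.crossingEdges P) ≤ #(Y ∪ H.crossingEdges P) :=
    card_le_card (union_subset_union_left h)
  unfold slack
  omega

/-- Edges crossing `P ⊔ Q` cross both partitions, and those crossing `P ⊓ Q` cross at least one, so
the cardinality term is submodular. The subtracted term is supermodular. -/
theorem slack_uncross (H : SimpleGraph V) (k : ℕ) (P Q : Setoid V) (X Y : Finset (Sym2 V)) :
    H.slack k (P ⊓ Q) (X ∪ Y) + H.slack k (P ⊔ Q) (X ∩ Y) ≤ H.slack k P X + H.slack k Q Y := by
  have h1 := card_union_add_card_inter (X ∪ H.crossingEdges P) (Y ∪ H.crossingEdges Q)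
  have h2 : #((X ∪ Y) ∪ H.crossingEdges (P ⊓ Q)) =
      #((X ∪ H.crossingEdges P) ∪ (Y ∪ H.crossingEdges Q)) := by
    rw [crossingEdges_inf, union_union_union_comm]
  have h3 : #((X ∩ Y) ∪ H.crossingEdges (P ⊔ Q)) ≤
      #((X ∪ H.crossingEdges P) ∩ (Y ∪ H.crossingEdges Q)) := by
    refine card_le_card (union_subset (inter_subset_inter subset_union_left subset_union_left)
      (subset_inter ?_ ?_))
    · exact (H.crossingEdges_anti le_sup_left).trans subset_union_right
    · exact (H.crossingEdges_anti le_sup_right).trans subset_union_right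
  have h4 := Setoid.card_quotient_add_le P Q
  have h5 : (k : ℤ) * (Nat.card (Quotient P) + Nat.card (Quotient Q)) ≤
      k * (Nat.card (Quotient (P ⊓ Q)) + Nat.card (Quotient (P ⊔ Q))) := by
    exact_mod_cast Nat.mul_le_mul_left k h4
  unfold slack
  zify at h1 h2 h3
  linarith

/-- No edge crosses the one-class partition. This bound makes the representatives in the transversal
distinct. -/
theorem slack_top_le [Nonempty V] (H : SimpleGraph V) (k : ℕ) (X : Finset (Sym2 V)) :
    H.slack k ⊤ X ≤ #X := by
  have h1 : H.crossingEdges ⊤ = ∅ := by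
    ext ⟨a, b⟩
    simp [mem_crossingEdges]
  have : Nonempty (Quotient (⊤ : Setoid V)) := ‹Nonempty V›.map (Quotient.mk _)
  have h2 : 0 < Nat.card (Quotient (⊤ : Setoid V)) := Nat.card_pos
  have : (0 : ℤ) ≤ k * ((Nat.card (Quotient (⊤ : Setoid V)) : ℤ) - 1) :=
    mul_nonneg (by positivity) (by omega)
  simp only [slack, h1, union_empty]
  omega

theorem sum_degree_le (H : SimpleGraph V) (J : Finset V) :
    ∑ x ∈ J, #(H.incidenceFinset x) ≤ 2 * #(J.biUnion fun x => H.incidenceFinset x) := by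
  refine sum_card_le_mul_card_biUnion J _ 2 ?_
  rintro ⟨a, b⟩
  refine (card_le_card (t := {a, b}) fun x hx => ?_).trans card_le_two
  have := (mem_incidenceFinset _ _ _).mp (mem_filter.mp hx).2
  simpa using this.2

/-- In a `k`-edge-connected graph, a partition into `n ≥ 2` classes is crossed by at least
`k n / 2` edges. -/
theorem IsEdgeConnected.mul_card_quotient_le {H : SimpleGraph V} {k : ℕ}
    (hH : H.IsEdgeConnected k) (P : Setoid V) (hP : 2 ≤ Nat.card (Quotient P)) :
    k * Nat.card (Quotient P) ≤ 2 * #(H.crossingEdges P) := by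
  have hnt : Nontrivial (Quotient P) := Finite.one_lt_card_iff_nontrivial.mp hP
  -- The edges leaving a class form a cut, and each crossing edge leaves exactly two classes.
  let B : Quotient P → Finset (Sym2 V) := fun c =>
    {e ∈ H.crossingEdges P | ∃ v ∈ e, Quotient.mk P v = c}
  have hB : ∀ c, k ≤ #(B c) := by
    intro c
    obtain ⟨d, hd⟩ := exists_ne c
    obtain ⟨u, rfl⟩ := Quotient.exists_rep c
    obtain ⟨v, rfl⟩ := Quotient.exists_rep d
    refine (H.isEdgeConnected_iff_le_card_cut k).mp hH {w | Quotient.mk P w = Quotient.mk P u}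
      u v rfl hd _ fun a b ha hb hab => ?_
    simp only [B, mem_filter, mem_crossingEdges]
    refine ⟨⟨hab, fun h => hb ?_⟩, a, by simp, ha⟩
    exact (Quotient.sound (P.symm h)).trans ha
  have h1 := sum_card_le_mul_card_biUnion univ B 2 (by
    rintro ⟨a, b⟩
    refine (card_le_card (t := {Quotient.mk P a, Quotient.mk P b}) fun c hc => ?_).trans card_le_two
    obtain ⟨-, v, hv, rfl⟩ := mem_filter.mp (mem_filter.mp hc).2
    rcases Sym2.mem_iff.mp hv with rfl | rfl <;> simp)
  have h2 := card_nsmul_le_sum univ (fun c => #(B c)) k fun c _ => hB c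
  have h3 : #(univ.biUnion B) ≤ #(H.crossingEdges P) :=
    card_le_card (biUnion_subset.mpr fun c _ => filter_subset _ _)
  rw [card_univ, smul_eq_mul, ← Nat.card_eq_fintype_card] at h2
  rw [mul_comm]
  omega

/-- A `16k`-edge-connected graph has a set `T` of edges whose removal leaves a `k`-edge-connected
graph and which contains `δ` edges at each vertex of degree at least `4δ`. -/
theorem IsEdgeConnected.exists_removable_edges {H : SimpleGraph V} {k : ℕ} (δ : ℕ)
    (hH : H.IsEdgeConnected (16 * k)) :
    ∃ T : Finset (Sym2 V), (T : Set (Sym2 V)) ⊆ H.edgeSet ∧ (H.deleteEdges T).IsEdgeConnected k ∧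
      ∀ x, 4 * δ ≤ #(H.incidenceFinset x) → δ ≤ #(T ∩ H.incidenceFinset x) := by
  rcases isEmpty_or_nonempty V with hV | hV
  · exact ⟨∅, by simp, fun u => isEmptyElim u, fun x => isEmptyElim x⟩
  let ι := {x : V // 4 * δ ≤ #(H.incidenceFinset x)} × Fin δ
  let A : ι → Finset (Sym2 V) := fun i => H.incidenceFinset i.1.1
  have hrado : ∀ (J : Finset ι) (P : Setoid V), (#J : ℤ) ≤ H.slack k P (J.biUnion A) := by
    intro J P
    set W : Finset V := J.image fun i => i.1.1 with hW
    have hU : J.biUnion A = W.biUnion fun x => H.incidenceFinset x := by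
      rw [hW, image_biUnion]
    have hJ : #J ≤ #W * δ := by
      refine (card_le_mul_card_image (f := fun i : ι => i.1.1) J δ fun x _ => ?_).trans
        (by rw [mul_comm])
      refine le_of_le_of_eq ?_ (card_univ.trans (Fintype.card_fin δ))
      refine card_le_card_of_injOn (fun i => i.2) (fun _ _ => mem_univ _) ?_
      intro i hi j hj hij
      have h1 := (mem_filter.mp hi).2
      have h2 := (mem_filter.mp hj).2
      exact Prod.ext (Subtype.ext (h1.trans h2.symm)) hij
    have hdeg : #W * (4 * δ) ≤ ∑ x ∈ W, #(H.incidenceFinset x) := by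
      rw [← smul_eq_mul]
      refine card_nsmul_le_sum _ _ _ fun x hx => ?_
      obtain ⟨i, -, rfl⟩ := mem_image.mp hx
      exact i.1.2
    have hsum := H.sum_degree_le W
    have hle : #(J.biUnion A) ≤ #(J.biUnion A ∪ H.crossingEdges P) :=
      card_le_card subset_union_left
    have hle' : #(H.crossingEdges P) ≤ #(J.biUnion A ∪ H.crossingEdges P) :=
      card_le_card subset_union_right
    rw [← hU] at hsum
    -- An edge has two ends, so 4δ|W| is at most twice the size of the union, while |J| ≤ δ|W|.
    have hJ' : 2 * #J ≤ #(J.biUnion A) := by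
      have : #W * (4 * δ) = 4 * (#W * δ) := by ring
      omega
    unfold slack
    -- A single class is crossed by no edge, but then the subtracted term vanishes.
    rcases Nat.lt_or_ge (Nat.card (Quotient P)) 2 with h1 | h2
    · have : Nonempty (Quotient P) := hV.map (Quotient.mk P)
      have hpos : 0 < Nat.card (Quotient P) := Nat.card_pos
      have : Nat.card (Quotient P) = 1 := by omega
      rw [this]
      simp
      omega
    · have := hH.mul_card_quotient_le P h2
      have hk : 8 * (k * Nat.card (Quotient P)) ≤ #(H.crossingEdges P) := by
        have : 16 * k * Nat.card (Quotient P) = 16 * (k * Nat.card (Quotient P)) := by ring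
        omega
      rw [mul_sub, mul_one, ← Nat.cast_mul]
      omega
  obtain ⟨t, htA, ht⟩ := exists_transversal_of_uncrossing (H.slack k) (H.slack_mono k)
    (fun P Q X Y => ⟨P ⊓ Q, P ⊔ Q, H.slack_uncross k P Q X Y⟩)
    ⟨⊤, by simpa using H.slack_top_le k ∅⟩ A hrado
  have hinj : Function.Injective t := by
    have h1 := (ht ⊤).trans (H.slack_top_le k _)
    refine Set.injOn_univ.mp ?_
    rw [← coe_univ, ← card_image_iff]
    refine le_antisymm card_image_le ?_
    rw [card_univ]
    omega
  refine ⟨univ.image t, ?_, ?_, ?_⟩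
  · intro e he
    obtain ⟨i, -, rfl⟩ := mem_image.mp he
    exact ((mem_incidenceFinset _ _ _).mp (htA i)).1
  · rw [isEdgeConnected_iff_le_card_cut]
    intro U u v hu hv s hs
    -- The partition into U and its complement: its slack bound leaves at least k edges of the cut
    -- outside T.
    let P : Setoid V := Setoid.ker fun w => w ∈ U
    have hPcard : 2 ≤ Nat.card (Quotient P) := by
      refine Finite.one_lt_card_iff_nontrivial.mpr
        ⟨Quotient.mk P u, Quotient.mk P v, fun h => hv ?_⟩
      have : (u ∈ U) = (v ∈ U) := Quotient.exact h
      exact this ▸ hu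
    have hsub : univ.image t ∪ H.crossingEdges P ⊆ univ.image t ∪ s := by
      refine union_subset subset_union_left ?_
      intro e
      induction e with | _ a b
      intro hab
      obtain ⟨hadj, hP⟩ := mem_crossingEdges.mp hab
      by_cases hT : s(a, b) ∈ univ.image t
      · exact mem_union_left _ hT
      refine mem_union_right _ ?_
      have hP' : ¬ (a ∈ U ↔ b ∈ U) := fun h => hP (propext h)
      by_cases ha : a ∈ U
      · exact hs a b ha (by tauto) (deleteEdges_adj.mpr ⟨hadj, hT⟩)
      · rw [Sym2.eq_swap] at hT ⊢
        exact hs b a (by tauto) ha (deleteEdges_adj.mpr ⟨hadj.symm, hT⟩)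
    have h1 := card_le_card hsub
    have h2 := card_union_le (univ.image t) s
    have h3 := ht P
    have h4 : #(univ.image t) ≤ Fintype.card ι := card_image_le
    have h5 : (k : ℤ) * 1 ≤ k * ((Nat.card (Quotient P) : ℤ) - 1) :=
      mul_le_mul_of_nonneg_left (by omega) (by positivity)
    unfold slack at h3
    omega
  · intro x hx
    have : univ.image (fun j : Fin δ => t (⟨x, hx⟩, j)) ⊆ univ.image t ∩ H.incidenceFinset x := by
      intro e he
      obtain ⟨j, -, rfl⟩ := mem_image.mp he
      exact mem_inter.mpr ⟨mem_image_of_mem _ (mem_univ _), htA (⟨x, hx⟩, j)⟩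
    refine le_trans ?_ (card_le_card this)
    rw [card_image_of_injective _ fun i j h => (Prod.ext_iff.mp (hinj h)).2]
    simp

end Crossing

end SimpleGraph

/-! ### The decomposition -/

theorem mainTheorem8 (k₀ δ₀ : ℕ) (hk₀ : 0 < k₀) (hδ₀ : 0 < δ₀) :
    ∃ d₀ : ℕ, ∀ (V : Type u) (S : Type v) [Finite V] (G : StubGraph V S),
      G.stubs.Finite → G.IsEdgeConnected (16 * k₀) → G.MinDegreeGE d₀ →
        ∃ A B : StubGraph V S, G.IsDecomposition A B ∧
          A.IsGraph ∧ A.IsEdgeConnected k₀ ∧ B.MinDegreeGE δ₀ := by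
  classical
  refine ⟨5 * δ₀, fun V S _ G _ hconn hdeg => ?_⟩
  have := Fintype.ofFinite V
  obtain ⟨T, hTG, hTconn, hTdeg⟩ :=
    SimpleGraph.IsEdgeConnected.exists_removable_edges (H := G.graph) δ₀ hconn
  have hTedge : (SimpleGraph.fromEdgeSet (T : Set (Sym2 V))).edgeSet = T := by
    rw [SimpleGraph.edgeSet_fromEdgeSet, sdiff_eq_left, Set.disjoint_left]
    exact fun e he => G.graph.not_isDiag_of_mem_edgeSet (hTG he)
  refine ⟨⟨G.graph.deleteEdges T, ∅, fun s => s.2.elim, fun s => s.2.elim⟩,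
    ⟨SimpleGraph.fromEdgeSet T, G.stubs, G.stubEnd, G.index⟩, ⟨?_, ?_, ?_, ?_⟩, rfl, hTconn, ?_⟩
  · exact ⟨G.graph.deleteEdges_le _, Set.empty_subset _, fun s => s.2.elim, fun s => s.2.elim⟩
  · refine ⟨?_, subset_rfl, fun _ => rfl, fun _ => rfl⟩
    rw [← SimpleGraph.edgeSet_subset_edgeSet, hTedge]
    exact hTG
  · simp only [StubGraph.edgeSet, SimpleGraph.edgeSet_deleteEdges, hTedge]
    rw [Set.disjoint_left]
    rintro (e | s) <;> simp
  · simp only [StubGraph.edgeSet, SimpleGraph.edgeSet_deleteEdges, hTedge]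
    ext (e | s)
    · have := @hTG e
      simp only [Set.image_empty, Set.union_empty, Set.mem_union, Set.mem_image, Sum.inl.injEq,
        exists_eq_right, Set.mem_sdiff, reduceCtorEq, and_false, exists_false, or_false]
      tauto
    · simp
  · intro x
    have hx := hdeg x
    simp only [StubGraph.degree] at hx ⊢
    by_cases hs : δ₀ ≤ {s : G.stubs | G.stubEnd s = x}.ncard
    · exact le_add_left hs
    have h1 : (G.graph.incidenceSet x).ncard = (G.graph.incidenceFinset x).card := by
      rw [← SimpleGraph.coe_incidenceFinset, Set.ncard_coe_finset]
    have h2 := hTdeg x (by omega)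
    refine le_add_right (h2.trans ?_)
    rw [← Set.ncard_coe_finset]
    refine Set.ncard_le_ncard (fun e he => ?_) (Set.toFinite _)
    obtain ⟨heT, hex⟩ := Finset.mem_inter.mp he
    refine ⟨?_, ((SimpleGraph.mem_incidenceFinset _ _ _).mp hex).2⟩
    rw [hTedge]
    exact heT
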